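/- Let $\Theta$ be a parameter set and let $(P_\vartheta)_{\vartheta\in\Theta}$ be probability distributions on $\mathbb R$ with finite means $\mu(\vartheta)$; write $kl(\beta\|\lambda)$ for the Kullback–Leibler divergence $\int \ln\frac{dP_\beta}{dP_\lambda}\,dP_\beta$ (equal to $+\infty$ if $P_\beta\not\ll P_\lambda$). Assume [A1]: (i) $0<kl(\beta\|\lambda)<\infty$ whenever $\mu(\lambda)>\mu(\beta)$; (ii) for all $\varepsilon>0$ and all $\beta,\lambda\in\Theta$ with $\mu(\lambda)>\mu(\beta)$ there is $\eta>0$ such that $|kl(\beta\|\lambda)-kl(\beta\|\lambda')|<\varepsilon$ whenever $\mu(\lambda)\le\mu(\lambda')\le\mu(\lambda)+\eta$; (iii) for all $\lambda\in\Theta$ and $\eta>0$ there is $\lambda'\in\Theta$ with $\mu(\lambda)<\mu(\lambda')<\mu(\lambda)+\eta$. Let $G=(V,E)$ be a finite connected undirected graph. All nodes face the same $K$-armed bandit problem with parameter vector $\boldsymbol\theta=(\theta_1,\dots,\theta_K)\in\Theta^K$: in each round $t=1,2,\dots$ every node $v$ chooses an arm $a^v(t)$ and receives a reward $X^v_{a^v(t)}(t)$,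 where the $X^v_i(t)$ ($v\in V$, $1\le i\le K$, $t\ge1$) are independent and $X^v_i(t)\sim P_{\theta_i}$. A network policy prescribes each $a^v(t)$ as a measurable function of the actions and rewards of $v$ and its neighbours in rounds $1,\dots,t-1$, and possibly of a random seed that is independent of all rewards and whose law does not depend on $\boldsymbol\theta$. Let $m_j^G(n)$ be the total number of times that arm $j$ is chosen by the nodes of $G$ in rounds $1,\dots,n$. Arm $j$ is sub-optimal for $\boldsymbol\theta$ if $\mu(\theta_j)<\max_i\mu(\theta_i)$. Consider a network policy such that, for every $\boldsymbol\theta\in\Theta^K$, every arm $j$ that is sub-optimal for $\boldsymbol\theta$, and every $c>0$, $\mathbb E_{\boldsymbol\theta}[m_j^G(n)]=o(n^c)$ as $n\to\infty$. Then, for every $\boldsymbol\theta\in\Theta^K$, every arm $j$ that is sub-optimal for $\boldsymbol\theta$, every $\theta^*\in\{\theta_1,\dots,\theta_K\}$ with $\mu(\theta^*)=\max_i\mu(\theta_i)$, and every $\delta\in(0,1)$, $$\liminf_{n\to\infty}\frac{\mathbb E_{\boldsymbol\theta}[m_j^G(n)]}{\ln n}\;\ge\;\frac{1-\delta}{1+\delta}\cdot\frac{1}{kl(\theta_j\|\theta^*)}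 .$$ -/

import Mathlib

open MeasureTheory Filter Asymptotics

noncomputable section

namespace NetworkBandit

variable {V Θ S : Type*} {K : ℕ}

/-- The mean of the reward distribution with parameter `a`. -/
def mean (P : Θ → Measure ℝ) (a : Θ) : ℝ := ∫ x, x ∂(P a)

/-- Kullback-Leibler divergence `kl(a ‖ b) = ∫ log (dP_a / dP_b) dP_a`, with values in `[0, ∞]`. -/
def kl (P : Θ → Measure ℝ) (a b : Θ) : ENNReal := InformationTheory.klDiv (P a) (P b)

/-- The regularity assumption on the parametric family of reward distributions. In `continuous`
both divergences are finite by `pos_finite`, so that `toReal` loses nothing. -/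
structure Regular (P : Θ → Measure ℝ) : Prop where
  pos_finite : ∀ β l : Θ, mean P β < mean P l → 0 < kl P β l ∧ kl P β l < ⊤
  continuous : ∀ ε : ℝ, 0 < ε → ∀ β l : Θ, mean P β < mean P l →
    ∃ δ : ℝ, 0 < δ ∧ ∀ l' : Θ, mean P l ≤ mean P l' → mean P l' ≤ mean P l + δ →
      |(kl P β l).toReal - (kl P β l').toReal| < ε
  dense : ∀ l : Θ, ∀ δ : ℝ, 0 < δ → ∃ l' : Θ, mean P l < mean P l' ∧ mean P l' < mean P l + δ

/-- Arm `j` is optimal for the parameter vector `θ`. -/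
def IsOptimal (P : Θ → Measure ℝ) (θ : Fin K → Θ) (j : Fin K) : Prop :=
  ∀ i, mean P (θ i) ≤ mean P (θ j)

/-- Arm `j` is sub-optimal for the parameter vector `θ`. -/
def IsSuboptimal (P : Θ → Measure ℝ) (θ : Fin K → Θ) (j : Fin K) : Prop :=
  ∃ i, mean P (θ j) < mean P (θ i)

/-- The closed neighbourhood of `v`: the node itself and its one-hop neighbours. -/
def closedNbhd (G : SimpleGraph V) (v : V) : Set V := {u | u = v ∨ G.Adj v u}

/-- What node `v` has observed after `t` rounds: the action and the reward of every node of its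
closed neighbourhood in each of these rounds (rounds are numbered from `0`). -/
abbrev History (G : SimpleGraph V) (K : ℕ) (v : V) (t : ℕ) : Type _ :=
  closedNbhd G v → Fin t → Fin K × ℝ

/-- A policy of the network `G`. In each round every node chooses an arm as a measurable function
of its own history and of a random seed, whose law does not depend on the parameters of the arms.
A one-point `S` gives the deterministic policies; a product space `S` with one factor per node
(or per node and round) gives nodes that randomise independently. -/
structure Policy (G : SimpleGraph V) (K : ℕ) (S : Type*) [MeasurableSpace S] where
  seedLaw : Measure S
  isProbabilityMeasure : IsProbabilityMeasure seedLaw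
  choice : (v : V) → (t : ℕ) → S × History G K v t → Fin K
  measurable_choice : ∀ v t, Measurable (choice v t)

/-- A table of rewards: `X (v, i, t)` is the reward that node `v` gets if it plays arm `i` in
round `t`. -/
abbrev RewardTable (V : Type*) (K : ℕ) : Type _ := V × Fin K × ℕ → ℝ

/-- The action of node `v` in round `t`, for the seed `s` and the rewards `X`. -/
def Policy.action {G : SimpleGraph V} [MeasurableSpace S] (Φ : Policy G K S)
    (s : S) (X : RewardTable V K) (t : ℕ) (v : V) : Fin K :=
  Φ.choice v t (s, fun u k => (Φ.action s X k u, X (u, Φ.action s X k u, k)))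
termination_by t
decreasing_by all_goals exact k.2

/-- The number of times arm `j` is chosen by all nodes together in the first `n` rounds. -/
def Policy.count {G : SimpleGraph V} [Fintype V] [MeasurableSpace S] (Φ : Policy G K S)
    (j : Fin K) (n : ℕ) (s : S) (X : RewardTable V K) : ℕ :=
  ∑ v : V, ∑ t ∈ Finset.range n, if Φ.action s X t v = j then 1 else 0

/-- The joint law of seed and rewards under the parameter vector `θ`: all the rewards and the seed
are independent, and the rewards of arm `i` have the law `P (θ i)`. -/
def Policy.law {G : SimpleGraph V} [MeasurableSpace S] (Φ : Policy G K S)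
    (P : Θ → Measure ℝ) [∀ a, IsProbabilityMeasure (P a)] (θ : Fin K → Θ) :
    Measure (S × RewardTable V K) :=
  Φ.seedLaw.prod (Measure.infinitePi fun p : V × Fin K × ℕ => P (θ p.2.1))

/-- The expected number of times arm `j` is chosen by all nodes together in the first `n` rounds,
under the parameter vector `θ`. -/
def Policy.expectedCount {G : SimpleGraph V} [Fintype V] [MeasurableSpace S] (Φ : Policy G K S)
    (P : Θ → Measure ℝ) [∀ a, IsProbabilityMeasure (P a)] (θ : Fin K → Θ) (j : Fin K) (n : ℕ) :
    ℝ :=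
  ∫ ω, (Φ.count j n ω.1 ω.2 : ℝ) ∂(Φ.law P θ)

/-- For every parameter vector and every arm that is sub-optimal for it, the expected network-wide
count of the arm is `o(n ^ c)` for all `c > 0`. -/
def Policy.Consistent {G : SimpleGraph V} [Fintype V] [MeasurableSpace S] (Φ : Policy G K S)
    (P : Θ → Measure ℝ) [∀ a, IsProbabilityMeasure (P a)] : Prop :=
  ∀ θ : Fin K → Θ, ∀ j : Fin K, IsSuboptimal P θ j → ∀ c : ℝ, 0 < c →
    (fun n : ℕ => Φ.expectedCount P θ j n) =o[atTop] (fun n : ℕ => (n : ℝ) ^ c)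

end NetworkBandit

end

/-
Change of measure. Replace the parameter of arm `j` by some `l` whose mean slightly exceeds the
best one. The policy and its seed do not see the parameters, so they cancel in the likelihood ratio
of the observed trajectories, whose divergence is therefore exactly `E[m_j(n)] * kl(θ_j ‖ l)`.
Under the alternative all arms but `j` are sub-optimal, so by consistency the fraction `u` of plays
of other arms has expectation at most `n ^ (c - 1)`; under `θ` its expectation tends to `1`. The
Donsker–Varadhan inequality for `(1 - c) * log n * u` turns this contrast into
`(1 - c) * log n * E_θ[u] ≤ E[m_j(n)] * kl(θ_j ‖ l) + log 2`.
Dividing by `log n`, let `n → ∞`, then `c → 0`, and finally let `l` approach the best arm.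
-/

namespace NetworkBandit

section InformationInequalities

variable {α : Type*} [MeasurableSpace α] {μ ν : Measure α} [IsProbabilityMeasure μ]
  [IsProbabilityMeasure ν]

/- Donsker–Varadhan: the right-hand side exceeds the left by the divergence of `μ` from the
tilted measure `exp f • ν / ∫ exp f ∂ν`. -/
lemma integral_le_toReal_klDiv_add_log_integral_exp {f : α → ℝ}
    (hkl : InformationTheory.klDiv μ ν ≠ ⊤) (hfμ : Integrable f μ)
    (hfν : Integrable (fun x => Real.exp (f x)) ν) :
    ∫ x, f x ∂μ ≤
      (InformationTheory.klDiv μ ν).toReal + Real.log (∫ x, Real.exp (f x) ∂ν) := by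
  obtain ⟨hac, hint⟩ := InformationTheory.klDiv_ne_top_iff.1 hkl
  have := isProbabilityMeasure_tilted hfν
  have hgibbs : 0 ≤ ∫ x, llr μ (ν.tilted f) x ∂μ := by
    rw [← InformationTheory.toReal_klDiv_of_measure_eq
      (hac.trans (absolutelyContinuous_tilted hfν)) (by simp only [measure_univ])]
    exact ENNReal.toReal_nonneg
  rw [integral_llr_tilted_right hac hfμ hfν hint] at hgibbs
  rw [InformationTheory.toReal_klDiv_of_measure_eq hac (by simp only [measure_univ])]
  linarith

lemma exp_mul_le_one_add_exp_mul {x u : ℝ} (hu : u ∈ Set.Icc (0 : ℝ) 1) :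
    Real.exp (x * u) ≤ 1 + Real.exp x * u := by
  have hconv := convexOn_exp.2 (Set.mem_univ 0) (Set.mem_univ x) (sub_nonneg.2 hu.2) hu.1
    (sub_add_cancel 1 u)
  simp only [smul_eq_mul, mul_zero, zero_add, Real.exp_zero, mul_one] at hconv
  rw [mul_comm x u, mul_comm _ u]
  linarith [hu.1]

lemma mul_integral_le_toReal_klDiv_add_log_two {u : α → ℝ} (hu : Measurable u)
    (hu01 : ∀ a, u a ∈ Set.Icc (0 : ℝ) 1) (hkl : InformationTheory.klDiv μ ν ≠ ⊤) {x : ℝ}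
    (hx : ∫ a, u a ∂ν ≤ Real.exp (-x)) :
    x * ∫ a, u a ∂μ ≤ (InformationTheory.klDiv μ ν).toReal + Real.log 2 := by
  have hint : ∀ (ρ : Measure α) [IsProbabilityMeasure ρ], Integrable u ρ := fun ρ _ =>
    .of_mem_Icc 0 1 hu.aemeasurable (ae_of_all _ hu01)
  have hexp_le : ∀ a, Real.exp (x * u a) ≤ 1 + Real.exp x * u a := fun a =>
    exp_mul_le_one_add_exp_mul (hu01 a)
  have hmajorant : Integrable (fun a => 1 + Real.exp x * u a) ν :=
    (integrable_const 1).add ((hint ν).const_mul _)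
  have hexp : Integrable (fun a => Real.exp (x * u a)) ν :=
    hmajorant.mono' (by fun_prop) (ae_of_all _ fun a => by
      rw [Real.norm_of_nonneg (Real.exp_pos _).le]
      exact hexp_le a)
  have hexp_le_two : ∫ a, Real.exp (x * u a) ∂ν ≤ 2 := calc
    ∫ a, Real.exp (x * u a) ∂ν ≤ ∫ a, (1 + Real.exp x * u a) ∂ν :=
      integral_mono hexp hmajorant hexp_le
    _ = 1 + Real.exp x * ∫ a, u a ∂ν := by
      rw [integral_add (integrable_const 1) ((hint ν).const_mul _), integral_const_mul]
      simp only [integral_const, probReal_univ, smul_eq_mul, mul_one]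
    _ ≤ 1 + Real.exp x * Real.exp (-x) := by gcongr
    _ = 2 := by rw [← Real.exp_add, add_neg_cancel, Real.exp_zero, one_add_one_eq_two]
  calc x * ∫ a, u a ∂μ = ∫ a, x * u a ∂μ := (integral_const_mul _ _).symm
    _ ≤ (InformationTheory.klDiv μ ν).toReal + Real.log (∫ a, Real.exp (x * u a) ∂ν) :=
      integral_le_toReal_klDiv_add_log_integral_exp hkl ((hint μ).const_mul x) hexp
    _ ≤ (InformationTheory.klDiv μ ν).toReal + Real.log 2 := by
      gcongr
      exact integral_exp_pos hexp

end InformationInequalities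

section ProductMeasures

variable {ι : Type*} [Fintype ι] {E : ι → Type*} [∀ i, MeasurableSpace (E i)]
  {μ ν : ∀ i, Measure (E i)} [∀ i, IsProbabilityMeasure (μ i)]

lemma lintegral_pi_prod {f : ∀ i, E i → ENNReal} (hf : ∀ i, Measurable (f i)) :
    ∫⁻ x, ∏ i, f i (x i) ∂Measure.pi μ = ∏ i, ∫⁻ x, f i x ∂μ i := by
  have hindep : ProbabilityTheory.iIndepFun (fun i x => f i (x i)) (Measure.pi μ) :=
    ProbabilityTheory.iIndepFun_pi fun i => (hf i).aemeasurable
  rw [ProbabilityTheory.lintegral_prod_eq_prod_lintegral_of_indepFun _ _ hindep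
    fun i => (hf i).comp (measurable_pi_apply i)]
  exact Finset.prod_congr rfl fun i _ => (measurePreserving_eval μ i).lintegral_comp (hf i)

lemma pi_eq_withDensity_prod [∀ i, SigmaFinite (ν i)] {f : ∀ i, E i → ENNReal}
    (hf : ∀ i, Measurable (f i)) (hν : ∀ i, ν i = (μ i).withDensity (f i)) :
    Measure.pi ν = (Measure.pi μ).withDensity fun x => ∏ i, f i (x i) := by
  refine Measure.pi_eq fun s hs => ?_
  have hindicator : (Set.univ.pi s).indicator (fun x => ∏ i, f i (x i)) =
      fun x => ∏ i, (s i).indicator (f i) (x i) := by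
    classical
    funext x
    by_cases hx : ∀ i, x i ∈ s i
    · rw [Set.indicator_of_mem (Set.mem_univ_pi.2 hx)]
      exact Finset.prod_congr rfl fun i _ => (Set.indicator_of_mem (hx i) _).symm
    · rw [Set.indicator_of_notMem (mt Set.mem_univ_pi.1 hx)]
      obtain ⟨i, hi⟩ := not_forall.1 hx
      exact (Finset.prod_eq_zero (Finset.mem_univ i) (Set.indicator_of_notMem hi _)).symm
  have hbox : MeasurableSet (Set.univ.pi s) := .univ_pi hs
  rw [withDensity_apply _ hbox, ← lintegral_indicator hbox, hindicator,
    lintegral_pi_prod fun i => (hf i).indicator (hs i)]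
  refine Finset.prod_congr rfl fun i _ => ?_
  rw [hν i, withDensity_apply _ (hs i), lintegral_indicator (hs i)]

end ProductMeasures

lemma lintegral_eq_tsum_fiber {α ι : Type*} [MeasurableSpace α] [Countable ι] [MeasurableSpace ι]
    [MeasurableSingletonClass ι] {g : α → ι} (hg : Measurable g) (μ : Measure α)
    (f : α → ENNReal) : ∫⁻ x, f x ∂μ = ∑' i, ∫⁻ x in g ⁻¹' {i}, f x ∂μ := by
  have hcover : ⋃ i, g ⁻¹' {i} = Set.univ := by
    rw [← Set.preimage_iUnion, Set.iUnion_of_singleton, Set.preimage_univ]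
  rw [← setLIntegral_univ, ← hcover, lintegral_iUnion (fun i => hg (measurableSet_singleton i))
    fun i k hik => (Set.disjoint_singleton.2 hik).preimage g]

lemma coe_le_of_forall_pos_coe_le {f : ℝ → ℝ} (hf : ContinuousAt f 0) {b : EReal}
    (h : ∀ ε, 0 < ε → (f ε : EReal) ≤ b) : (f 0 : EReal) ≤ b :=
  le_of_tendsto ((continuous_coe_real_ereal.tendsto _).comp
    (hf.tendsto.mono_left (nhdsWithin_le_nhds (s := Set.Ioi 0))))
    (eventually_nhdsWithin_of_forall h)

section Trajectories

variable {V Θ S : Type*} {K : ℕ} {G : SimpleGraph V} [MeasurableSpace S]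

lemma Policy.action_congr (Φ : Policy G K S) (s : S) {X Y : RewardTable V K} (t : ℕ)
    (h : ∀ k < t, ∀ u, X (u, Φ.action s X k u, k) = Y (u, Φ.action s X k u, k)) :
    Φ.action s X t = Φ.action s Y t := by
  induction t using Nat.strong_induction_on with
  | _ t ih =>
    have hpast : ∀ k < t, Φ.action s X k = Φ.action s Y k := fun k hk =>
      ih k hk fun l hl u => h l (hl.trans hk) u
    funext v
    rw [Policy.action, Policy.action]
    congr 2
    funext u k
    rw [h k k.2 u, hpast k k.2]

lemma measurable_reward (v : V) (t : ℕ) :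
    Measurable fun p : Fin K × RewardTable V K => p.2 (v, p.1, t) :=
  measurable_from_prod_countable_right fun i => measurable_pi_apply (v, i, t)

lemma Policy.measurable_action (Φ : Policy G K S) (t : ℕ) (v : V) :
    Measurable fun ω : S × RewardTable V K => Φ.action ω.1 ω.2 t v := by
  induction t using Nat.strong_induction_on generalizing v with
  | _ t ih =>
    have hpast : ∀ (u : V) (k : Fin t), Measurable fun ω : S × RewardTable V K =>
        (Φ.action ω.1 ω.2 k u, ω.2 (u, Φ.action ω.1 ω.2 k u, k)) := fun u k =>
      (ih k k.2 u).prodMk ((measurable_reward u k).comp ((ih k k.2 u).prodMk measurable_snd))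
    simp_rw [Policy.action.eq_def Φ _ _ t v]
    exact (Φ.measurable_choice v t).comp (measurable_fst.prodMk
      (measurable_pi_lambda _ fun u => measurable_pi_lambda _ fun k => hpast u k))

/-- The actions of all nodes in the first `n` rounds. -/
def Policy.actions (Φ : Policy G K S) (n : ℕ) (s : S) (X : RewardTable V K) : V × Fin n → Fin K :=
  fun q => Φ.action s X q.2 q.1

/-- What the whole network sees of the reward table in the first `n` rounds: the action of every
node in every round, paired with the reward it earned. -/
def Policy.trajectory (Φ : Policy G K S) (n : ℕ) (s : S) (X : RewardTable V K) :
    V × Fin n → Fin K × ℝ :=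
  fun q => (Φ.actions n s X q, X (q.1, Φ.actions n s X q, q.2))

lemma Policy.measurable_actions (Φ : Policy G K S) (n : ℕ) :
    Measurable fun ω : S × RewardTable V K => Φ.actions n ω.1 ω.2 :=
  measurable_pi_lambda _ fun q => Φ.measurable_action q.2 q.1

lemma Policy.measurable_trajectory (Φ : Policy G K S) (n : ℕ) :
    Measurable fun ω : S × RewardTable V K => Φ.trajectory n ω.1 ω.2 :=
  measurable_pi_lambda _ fun q => (Φ.measurable_action q.2 q.1).prodMk
    ((measurable_reward q.1 q.2).comp ((Φ.measurable_action q.2 q.1).prodMk measurable_snd))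

/-- The reward table in which the reward of node `v` in round `t < n` is `y (v, t)`, whichever arm
it plays. Later rewards never matter and are set to `0`. -/
def armBlindTable (K n : ℕ) (y : V × Fin n → ℝ) : RewardTable V K :=
  fun p => if h : p.2.2 < n then y (p.1, ⟨p.2.2, h⟩) else 0

lemma measurable_armBlindTable (K n : ℕ) : Measurable (armBlindTable (V := V) K n) := by
  refine measurable_pi_lambda _ fun p => ?_
  unfold armBlindTable
  split_ifs with h
  · exact measurable_pi_apply _
  · exact measurable_const

lemma Policy.actions_eq_of_forall_eq (Φ : Policy G K S) {n : ℕ} {s : S} {X Y : RewardTable V K}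
    {a : V × Fin n → Fin K} (hXY : ∀ q, X (q.1, a q, q.2) = Y (q.1, a q, q.2))
    (hX : Φ.actions n s X = a) : Φ.actions n s Y = a := by
  subst hX
  funext q
  exact (congrFun (Φ.action_congr s q.2 fun k hk u => hXY (u, ⟨k, hk.trans q.2.2⟩)) q.1).symm

lemma Policy.actions_armBlindTable_eq_iff (Φ : Policy G K S) {n : ℕ} {s : S} {X : RewardTable V K}
    {a : V × Fin n → Fin K} :
    Φ.actions n s (armBlindTable K n fun q => X (q.1, a q, q.2)) = a ↔ Φ.actions n s X = a := by
  have hagree : ∀ q : V × Fin n,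
      armBlindTable K n (fun q => X (q.1, a q, q.2)) (q.1, a q, q.2) = X (q.1, a q, q.2) :=
    fun q => dif_pos q.2.2
  exact ⟨Φ.actions_eq_of_forall_eq hagree, Φ.actions_eq_of_forall_eq fun q => (hagree q).symm⟩

end Trajectories

section TrajectoryLaw

variable {V Θ S : Type*} {K : ℕ} {G : SimpleGraph V} [MeasurableSpace S]
  (P : Θ → Measure ℝ)

section LikelihoodRatio

variable [Fintype V]

/-- The likelihood ratio of a trajectory under `θ` and `θ'`. The probabilities with which the policy
chooses its actions are the same under both and cancel. -/
noncomputable def likelihoodRatio (θ θ' : Fin K → Θ) {n : ℕ} (h : V × Fin n → Fin K × ℝ) :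
    ENNReal :=
  ∏ q, (P (θ (h q).1)).rnDeriv (P (θ' (h q).1)) (h q).2

lemma measurable_likelihoodRatio (θ θ' : Fin K → Θ) (n : ℕ) :
    Measurable (likelihoodRatio (V := V) (n := n) P θ θ') := by
  have hratio : Measurable fun p : Fin K × ℝ => (P (θ p.1)).rnDeriv (P (θ' p.1)) p.2 :=
    measurable_from_prod_countable_right fun i =>
      Measure.measurable_rnDeriv (P (θ i)) (P (θ' i))
  exact Finset.measurable_prod _ fun q _ => hratio.comp (measurable_pi_apply q)

end LikelihoodRatio

variable [∀ a, IsProbabilityMeasure (P a)]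

/-- The joint law of all rewards under the parameter vector `θ`. -/
noncomputable abbrev rewardLaw (V : Type*) (θ : Fin K → Θ) : Measure (RewardTable V K) :=
  Measure.infinitePi fun p : V × Fin K × ℕ => P (θ p.2.1)

lemma Policy.isProbabilityMeasure_law (Φ : Policy G K S) (θ : Fin K → Θ) :
    IsProbabilityMeasure (Φ.law P θ) := by
  have := Φ.isProbabilityMeasure
  unfold Policy.law
  infer_instance

/-- The law of the trajectory of the first `n` rounds under the parameter vector `θ`. -/
noncomputable def Policy.trajectoryLaw (Φ : Policy G K S) (θ : Fin K → Θ) (n : ℕ) :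
    Measure (V × Fin n → Fin K × ℝ) :=
  (Φ.law P θ).map fun ω => Φ.trajectory n ω.1 ω.2

instance Policy.isProbabilityMeasure_trajectoryLaw (Φ : Policy G K S) (θ : Fin K → Θ) (n : ℕ) :
    IsProbabilityMeasure (Φ.trajectoryLaw P θ n) :=
  have := Φ.isProbabilityMeasure_law P θ
  Measure.isProbabilityMeasure_map (Φ.measurable_trajectory n).aemeasurable

variable [Fintype V]

lemma map_rewardLaw_eq_pi (θ : Fin K → Θ) {n : ℕ} (a : V × Fin n → Fin K) :
    (rewardLaw P V θ).map (fun X q => X (q.1, a q, (q.2 : ℕ))) =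
      Measure.pi fun q => P (θ (a q)) := by
  have hinj : Function.Injective fun q : V × Fin n => (q.1, a q, (q.2 : ℕ)) := fun q r hqr => by
    simp only [Prod.mk.injEq] at hqr
    exact Prod.ext hqr.1 (Fin.ext hqr.2.2)
  rw [rewardLaw, Measure.map_infinitePi_infinitePi_of_inj hinj, Measure.infinitePi_eq_pi]

/- Once the actions are fixed to be `a`, the trajectory only depends on the rewards of `a`, which
are independent. -/
lemma Policy.lintegral_trajectory (Φ : Policy G K S) (θ : Fin K → Θ) (n : ℕ) (s : S)
    {F : (V × Fin n → Fin K × ℝ) → ENNReal} (hF : Measurable F) :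
    ∫⁻ X, F (Φ.trajectory n s X) ∂rewardLaw P V θ =
      ∑' a : V × Fin n → Fin K, ∫⁻ y in {y | Φ.actions n s (armBlindTable K n y) = a},
        F (fun q => (a q, y q)) ∂Measure.pi fun q => P (θ (a q)) := by
  have hactions : Measurable (Φ.actions n s) :=
    (Φ.measurable_actions n).comp measurable_prodMk_left
  rw [lintegral_eq_tsum_fiber hactions]
  refine tsum_congr fun a => ?_
  have hfiber : Φ.actions n s ⁻¹' {a} = (fun X q => X (q.1, a q, (q.2 : ℕ))) ⁻¹'
      {y | Φ.actions n s (armBlindTable K n y) = a} :=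
    Set.ext fun X => Φ.actions_armBlindTable_eq_iff.symm
  have hF_eq : ∀ X ∈ Φ.actions n s ⁻¹' {a},
      F (Φ.trajectory n s X) = F fun q => (a q, X (q.1, a q, q.2)) := by
    rintro X rfl
    rfl
  rw [setLIntegral_congr_fun (hactions (measurableSet_singleton a)) hF_eq, hfiber,
    ← map_rewardLaw_eq_pi, setLIntegral_map]
  · exact hactions.comp (measurable_armBlindTable K n) (measurableSet_singleton a)
  · fun_prop
  · fun_prop

lemma Policy.lintegral_trajectoryLaw (Φ : Policy G K S) (θ : Fin K → Θ) (n : ℕ)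
    {F : (V × Fin n → Fin K × ℝ) → ENNReal} (hF : Measurable F) :
    ∫⁻ h, F h ∂Φ.trajectoryLaw P θ n =
      ∫⁻ s, ∑' a : V × Fin n → Fin K, ∫⁻ y in {y | Φ.actions n s (armBlindTable K n y) = a},
        F (fun q => (a q, y q)) ∂Measure.pi (fun q => P (θ (a q))) ∂Φ.seedLaw := by
  rw [Policy.trajectoryLaw, lintegral_map hF (Φ.measurable_trajectory n), Policy.law,
    lintegral_prod (fun ω => F (Φ.trajectory n ω.1 ω.2))
      (hF.comp (Φ.measurable_trajectory n)).aemeasurable]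
  exact lintegral_congr fun s => Φ.lintegral_trajectory P θ n s hF

lemma Policy.trajectoryLaw_eq_withDensity_likelihoodRatio (Φ : Policy G K S) {θ θ' : Fin K → Θ}
    (hac : ∀ i, P (θ i) ≪ P (θ' i)) (n : ℕ) :
    Φ.trajectoryLaw P θ n = (Φ.trajectoryLaw P θ' n).withDensity (likelihoodRatio P θ θ') := by
  have hlr := measurable_likelihoodRatio (V := V) P θ θ' n
  refine Measure.ext_of_lintegral _ fun F hF => ?_
  rw [lintegral_withDensity_eq_lintegral_mul _ hlr hF, Φ.lintegral_trajectoryLaw P θ n hF,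
    Φ.lintegral_trajectoryLaw P θ' n (hlr.mul hF)]
  refine lintegral_congr fun s => tsum_congr fun a => ?_
  have hpi : Measure.pi (fun q => P (θ (a q))) = (Measure.pi fun q => P (θ' (a q))).withDensity
      fun y => ∏ q, (P (θ (a q))).rnDeriv (P (θ' (a q))) (y q) :=
    pi_eq_withDensity_prod (fun q => Measure.measurable_rnDeriv _ _)
      fun q => (Measure.withDensity_rnDeriv_eq _ _ (hac (a q))).symm
  have hmeas : MeasurableSet {y | Φ.actions n s (armBlindTable K n y) = a} :=
    ((Φ.measurable_actions n).comp measurable_prodMk_left).comp (measurable_armBlindTable K n)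
      (measurableSet_singleton a)
  rw [hpi, setLIntegral_withDensity_eq_setLIntegral_mul _ (by fun_prop) (by fun_prop) hmeas]
  rfl

lemma Policy.llr_trajectoryLaw (Φ : Policy G K S) {θ θ' : Fin K → Θ}
    (hac : ∀ i, P (θ i) ≪ P (θ' i)) (n : ℕ) :
    llr (Φ.trajectoryLaw P θ n) (Φ.trajectoryLaw P θ' n) =ᵐ[Φ.trajectoryLaw P θ n]
      fun h => ∑ q, llr (P (θ (h q).1)) (P (θ' (h q).1)) (h q).2 := by
  have htraj : Φ.trajectoryLaw P θ n ≪ Φ.trajectoryLaw P θ' n :=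
    (Φ.trajectoryLaw_eq_withDensity_likelihoodRatio P hac n).absolutelyContinuous.trans
      (withDensity_absolutelyContinuous _ _)
  have hderiv : (Φ.trajectoryLaw P θ n).rnDeriv (Φ.trajectoryLaw P θ' n)
      =ᵐ[Φ.trajectoryLaw P θ' n] likelihoodRatio P θ θ' := by
    conv_lhs => rw [Φ.trajectoryLaw_eq_withDensity_likelihoodRatio P hac n]
    exact Measure.rnDeriv_withDensity _ (measurable_likelihoodRatio P θ θ' n)
  filter_upwards [htraj.ae_le hderiv, exp_llr_of_ac _ _ htraj] with h hh hexp
  rw [hh, likelihoodRatio, ENNReal.toReal_prod] at hexp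
  have hfactor_ne := Finset.prod_ne_zero_iff.1 (hexp ▸ Real.exp_ne_zero _)
  rw [llr, hh, likelihoodRatio, ENNReal.toReal_prod, Real.log_prod hfactor_ne]
  rfl

end TrajectoryLaw

section Independence

open ProbabilityTheory

lemma indepFun_eval_of_dependsOn {ι β : Type*} {E : ι → Type*} [∀ i, MeasurableSpace (E i)]
    [MeasurableSpace β] {μ : ∀ i, Measure (E i)} [∀ i, IsProbabilityMeasure (μ i)]
    {g : (∀ i, E i) → β} (hg : Measurable g) {T : Finset ι} (hT : DependsOn g T) {i : ι}
    (hi : i ∉ T) : IndepFun g (fun x => x i) (Measure.infinitePi μ) := by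
  classical
  obtain ⟨x₀⟩ := nonempty_of_isProbabilityMeasure (Measure.infinitePi μ)
  have hindep := (iIndepFun_infinitePi (P := μ) (X := fun _ x => x)
    fun _ => measurable_id).indepFun_finset T {i} (Finset.disjoint_singleton_right.2 hi)
      fun k => measurable_pi_apply k
  have hg_eq : g = (g ∘ Function.updateFinset x₀ T) ∘ fun x (k : T) => x k := by
    funext x
    exact hT fun k hk => by simp [Function.updateFinset, Finset.mem_coe.1 hk]
  rw [hg_eq]
  exact hindep.comp (hg.comp measurable_updateFinset)
    (measurable_pi_apply (⟨i, Finset.mem_singleton_self i⟩ : ({i} : Finset ι)))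

lemma indepFun_prod_of_forall_indepFun {α β γ δ : Type*} [MeasurableSpace α] [MeasurableSpace β]
    [MeasurableSpace γ] [MeasurableSpace δ] {ρ : Measure α} [IsProbabilityMeasure ρ]
    {μ : Measure β} [IsProbabilityMeasure μ] {f : α × β → γ} (hf : Measurable f) {g : β → δ}
    (hg : Measurable g) (hindep : ∀ a, IndepFun (fun b => f (a, b)) g μ) :
    IndepFun f (g ∘ Prod.snd) (ρ.prod μ) := by
  refine indepFun_iff_measure_inter_preimage_eq_mul.2 fun s t hs ht => ?_
  have hsnd : (ρ.prod μ) (g ∘ Prod.snd ⁻¹' t) = μ (g ⁻¹' t) :=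
    measurePreserving_snd.measure_preimage (hg ht).nullMeasurableSet
  rw [hsnd, Measure.prod_apply ((hf hs).inter ((hg.comp measurable_snd) ht)),
    Measure.prod_apply (hf hs), ← lintegral_mul_const _ (measurable_measure_prodMk_left (hf hs))]
  exact lintegral_congr fun a => (hindep a).measure_inter_preimage_eq_mul _ _ hs ht

end Independence

section ActionRewardIndependence

variable {V Θ S : Type*} {K : ℕ} {G : SimpleGraph V} [MeasurableSpace S] (P : Θ → Measure ℝ)
  [∀ a, IsProbabilityMeasure (P a)]

/- The action of round `t` is determined by the rewards of the earlier rounds. -/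
lemma Policy.indepFun_action_reward [Finite V] (Φ : Policy G K S) (θ : Fin K → Θ) (v : V)
    (i : Fin K) (t : ℕ) :
    ProbabilityTheory.IndepFun (fun ω : S × RewardTable V K => Φ.action ω.1 ω.2 t v)
      (fun ω => ω.2 (v, i, t)) (Φ.law P θ) := by
  have := Fintype.ofFinite V
  have := Φ.isProbabilityMeasure
  refine indepFun_prod_of_forall_indepFun (Φ.measurable_action t v)
    (measurable_pi_apply (v, i, t)) fun s => ?_
  refine indepFun_eval_of_dependsOn ((Φ.measurable_action t v).comp measurable_prodMk_left)
    (T := Finset.univ ×ˢ Finset.univ ×ˢ Finset.range t) (fun X Y hXY => ?_) (by simp)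
  exact congrFun (Φ.action_congr s t fun k hk u => hXY _ (by simpa using hk)) v

lemma Policy.measurePreserving_reward (Φ : Policy G K S) (θ : Fin K → Θ) (v : V) (i : Fin K)
    (t : ℕ) : MeasurePreserving (fun ω : S × RewardTable V K => ω.2 (v, i, t)) (Φ.law P θ)
      (P (θ i)) :=
  have := Φ.isProbabilityMeasure
  (measurePreserving_eval_infinitePi (fun p : V × Fin K × ℕ => P (θ p.2.1)) (v, i, t)).comp
    measurePreserving_snd

lemma Policy.integrable_ite_action_mul_reward [Finite V] (Φ : Policy G K S) (θ : Fin K → Θ)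
    (v : V) {i : Fin K} (t : ℕ) {f : ℝ → ℝ} (hf : Integrable f (P (θ i))) :
    Integrable (fun ω => (if Φ.action ω.1 ω.2 t v = i then 1 else 0) * f (ω.2 (v, i, t)))
      (Φ.law P θ) := by
  have hite : Measurable fun a : Fin K => (if a = i then 1 else 0 : ℝ) := .of_discrete
  exact ((Φ.measurePreserving_reward P θ v i t).integrable_comp_of_integrable hf).bdd_mul (c := 1)
    (hite.comp (Φ.measurable_action t v)).aestronglyMeasurable
    (ae_of_all _ fun ω => by split_ifs <;> simp)

lemma Policy.integral_ite_action_mul_reward [Finite V] (Φ : Policy G K S) (θ : Fin K → Θ)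
    (v : V) (i : Fin K) (t : ℕ) {f : ℝ → ℝ} (hf : Measurable f) :
    ∫ ω, (if Φ.action ω.1 ω.2 t v = i then 1 else 0) * f (ω.2 (v, i, t)) ∂Φ.law P θ =
      (∫ ω, (if Φ.action ω.1 ω.2 t v = i then 1 else 0) ∂Φ.law P θ) * ∫ x, f x ∂P (θ i) := by
  have hite : Measurable fun a : Fin K => (if a = i then 1 else 0 : ℝ) := .of_discrete
  have hreward := Φ.measurePreserving_reward P θ v i t
  rw [← hreward.map_eq, integral_map hreward.measurable.aemeasurable hf.aestronglyMeasurable]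
  exact ((Φ.indepFun_action_reward P θ v i t).comp hite hf).integral_fun_mul_eq_mul_integral
    (hite.comp (Φ.measurable_action t v)).aestronglyMeasurable
    (hf.comp hreward.measurable).aestronglyMeasurable

end ActionRewardIndependence

section DivergenceDecomposition

variable {V Θ S : Type*} {K : ℕ} {G : SimpleGraph V} [Fintype V] [MeasurableSpace S]

/-- How often arm `j` is played along a trajectory. -/
def pullCount {n : ℕ} (j : Fin K) (h : V × Fin n → Fin K × ℝ) : ℕ :=
  ∑ q, if (h q).1 = j then 1 else 0

lemma measurable_pullCount {n : ℕ} (j : Fin K) :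
    Measurable fun h : V × Fin n → Fin K × ℝ => (pullCount j h : ℝ) := by
  have hite : Measurable fun a : Fin K => if a = j then 1 else 0 := .of_discrete
  have hcount : Measurable fun h : V × Fin n → Fin K × ℝ => pullCount j h :=
    Finset.measurable_sum _ fun q _ => hite.comp (measurable_fst.comp (measurable_pi_apply q))
  exact measurable_from_nat.comp hcount

lemma sum_pullCount {n : ℕ} (h : V × Fin n → Fin K × ℝ) :
    ∑ j, pullCount j h = Fintype.card (V × Fin n) := by
  simp only [pullCount]
  rw [Finset.sum_comm]
  simp only [Finset.sum_ite_eq, Finset.mem_univ, if_true, Finset.sum_const, Finset.card_univ,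
    smul_eq_mul, mul_one]

lemma pullCount_le_card {n : ℕ} (j : Fin K) (h : V × Fin n → Fin K × ℝ) :
    pullCount j h ≤ Fintype.card (V × Fin n) :=
  (Finset.single_le_sum (fun i _ => Nat.zero_le (pullCount i h)) (Finset.mem_univ j)).trans_eq
    (sum_pullCount h)

lemma integrable_pullCount {n : ℕ} (j : Fin K) (ρ : Measure (V × Fin n → Fin K × ℝ))
    [IsFiniteMeasure ρ] : Integrable (fun h => (pullCount j h : ℝ)) ρ :=
  .of_mem_Icc 0 (Fintype.card (V × Fin n)) (measurable_pullCount j).aemeasurable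
    (ae_of_all _ fun h => ⟨Nat.cast_nonneg _, Nat.cast_le.2 (pullCount_le_card j h)⟩)

lemma Policy.pullCount_trajectory (Φ : Policy G K S) (j : Fin K) (n : ℕ) (s : S)
    (X : RewardTable V K) : pullCount j (Φ.trajectory n s X) = Φ.count j n s X := by
  simp only [pullCount, Policy.count, Fintype.sum_prod_type, Finset.sum_range]
  rfl

variable (P : Θ → Measure ℝ) [∀ a, IsProbabilityMeasure (P a)]

lemma Policy.integral_pullCount (Φ : Policy G K S) (θ : Fin K → Θ) (j : Fin K) (n : ℕ) :
    ∫ h, (pullCount j h : ℝ) ∂Φ.trajectoryLaw P θ n = Φ.expectedCount P θ j n := by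
  rw [Policy.trajectoryLaw, integral_map (Φ.measurable_trajectory n).aemeasurable
    (measurable_pullCount j).aestronglyMeasurable, Policy.expectedCount]
  simp only [Φ.pullCount_trajectory]

lemma Policy.expectedCount_nonneg (Φ : Policy G K S) (θ : Fin K → Θ) (j : Fin K) (n : ℕ) :
    0 ≤ Φ.expectedCount P θ j n :=
  integral_nonneg fun _ => Nat.cast_nonneg _

lemma Policy.sum_expectedCount (Φ : Policy G K S) (θ : Fin K → Θ) (n : ℕ) :
    ∑ j, Φ.expectedCount P θ j n = Fintype.card (V × Fin n) := by
  simp_rw [← Φ.integral_pullCount P θ]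
  rw [← integral_finsetSum _ fun j _ => integrable_pullCount j _]
  simp_rw [← Nat.cast_sum, sum_pullCount, integral_const, probReal_univ, one_smul]

lemma Policy.expectedCount_eq_sum_integral (Φ : Policy G K S) (θ : Fin K → Θ) (j : Fin K)
    (n : ℕ) : Φ.expectedCount P θ j n = ∑ q : V × Fin n,
      ∫ ω, (if Φ.action ω.1 ω.2 q.2 q.1 = j then 1 else 0) ∂Φ.law P θ := by
  have := Φ.isProbabilityMeasure_law P θ
  have hplayed : ∀ q : V × Fin n, Integrable (fun ω : S × RewardTable V K =>
      if Φ.action ω.1 ω.2 q.2 q.1 = j then (1 : ℝ) else 0) (Φ.law P θ) := fun q => by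
    simpa only [mul_one] using Φ.integrable_ite_action_mul_reward P θ q.1 q.2 (i := j)
      (integrable_const 1)
  rw [Policy.expectedCount, ← integral_finsetSum _ fun q _ => hplayed q]
  simp only [← Φ.pullCount_trajectory, pullCount, Nat.cast_sum, Nat.cast_ite, Nat.cast_one,
    Nat.cast_zero]
  rfl

lemma Policy.sum_trajectory_eq (Φ : Policy G K S) (ℓ : Fin K → ℝ → ℝ) (n : ℕ) (s : S)
    (X : RewardTable V K) :
    ∑ q, ℓ (Φ.trajectory n s X q).1 (Φ.trajectory n s X q).2 =
      ∑ q : V × Fin n, ∑ i,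
        (if Φ.action s X q.2 q.1 = i then 1 else 0) * ℓ i (X (q.1, i, q.2)) := by
  simp only [ite_mul, one_mul, zero_mul, Finset.sum_ite_eq, Finset.mem_univ, if_true]
  rfl

lemma measurable_sum_trajectory {ℓ : Fin K → ℝ → ℝ} (hℓ : ∀ i, Measurable (ℓ i)) (n : ℕ) :
    Measurable fun h : V × Fin n → Fin K × ℝ => ∑ q, ℓ (h q).1 (h q).2 := by
  have hpair : Measurable fun p : Fin K × ℝ => ℓ p.1 p.2 :=
    measurable_from_prod_countable_right hℓ
  exact Finset.measurable_sum _ fun q _ => hpair.comp (measurable_pi_apply q)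

lemma Policy.integrable_sum_trajectory (Φ : Policy G K S) {θ : Fin K → Θ} {ℓ : Fin K → ℝ → ℝ}
    (hℓ : ∀ i, Measurable (ℓ i)) (hint : ∀ i, Integrable (ℓ i) (P (θ i))) (n : ℕ) :
    Integrable (fun h => ∑ q, ℓ (h q).1 (h q).2) (Φ.trajectoryLaw P θ n) := by
  refine (integrable_map_measure (measurable_sum_trajectory hℓ n).aestronglyMeasurable
    (Φ.measurable_trajectory n).aemeasurable).2 ?_
  simp only [Function.comp_def, Φ.sum_trajectory_eq ℓ]
  exact integrable_finsetSum _ fun q _ => integrable_finsetSum _ fun i _ =>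
    Φ.integrable_ite_action_mul_reward P θ q.1 q.2 (hint i)

/- Wald's identity: whether arm `i` is played in round `t` is independent of its reward then. -/
lemma Policy.integral_sum_trajectory (Φ : Policy G K S) {θ : Fin K → Θ} {ℓ : Fin K → ℝ → ℝ}
    (hℓ : ∀ i, Measurable (ℓ i)) (hint : ∀ i, Integrable (ℓ i) (P (θ i))) (n : ℕ) :
    ∫ h, ∑ q, ℓ (h q).1 (h q).2 ∂Φ.trajectoryLaw P θ n =
      ∑ i, Φ.expectedCount P θ i n * ∫ x, ℓ i x ∂P (θ i) := by
  have hterm : ∀ (q : V × Fin n) (i : Fin K), Integrable (fun ω =>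
      (if Φ.action ω.1 ω.2 q.2 q.1 = i then 1 else 0) * ℓ i (ω.2 (q.1, i, q.2))) (Φ.law P θ) :=
    fun q i => Φ.integrable_ite_action_mul_reward P θ q.1 q.2 (hint i)
  rw [Policy.trajectoryLaw, integral_map (Φ.measurable_trajectory n).aemeasurable
    (measurable_sum_trajectory hℓ n).aestronglyMeasurable]
  simp only [Φ.sum_trajectory_eq ℓ]
  rw [integral_finsetSum _ fun q _ => integrable_finsetSum _ fun i _ => hterm q i]
  simp_rw [integral_finsetSum _ fun i _ => hterm _ i,
    Φ.integral_ite_action_mul_reward P θ _ _ _ (hℓ _)]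
  rw [Finset.sum_comm]
  simp_rw [Φ.expectedCount_eq_sum_integral P, Finset.sum_mul]

lemma Policy.klDiv_trajectoryLaw (Φ : Policy G K S) {θ θ' : Fin K → Θ}
    (hkl : ∀ i, kl P (θ i) (θ' i) ≠ ⊤) (n : ℕ) :
    InformationTheory.klDiv (Φ.trajectoryLaw P θ n) (Φ.trajectoryLaw P θ' n) =
      ∑ i, ENNReal.ofReal (Φ.expectedCount P θ i n) * kl P (θ i) (θ' i) := by
  choose hac hint using fun i => InformationTheory.klDiv_ne_top_iff.1 (hkl i)
  have htraj : Φ.trajectoryLaw P θ n ≪ Φ.trajectoryLaw P θ' n :=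
    (Φ.trajectoryLaw_eq_withDensity_likelihoodRatio P hac n).absolutelyContinuous.trans
      (withDensity_absolutelyContinuous _ _)
  have hllr := Φ.llr_trajectoryLaw P hac n
  have hllr_int : Integrable (llr (Φ.trajectoryLaw P θ n) (Φ.trajectoryLaw P θ' n))
      (Φ.trajectoryLaw P θ n) := (integrable_congr hllr).2
    (Φ.integrable_sum_trajectory P (fun i => measurable_llr _ _) hint n)
  have harm : ∀ i, ∫ x, llr (P (θ i)) (P (θ' i)) x ∂P (θ i) = (kl P (θ i) (θ' i)).toReal :=
    fun i => (InformationTheory.toReal_klDiv_of_measure_eq (hac i)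
      (by simp only [measure_univ])).symm
  rw [InformationTheory.klDiv_of_ac_of_integrable htraj hllr_int, probReal_univ, probReal_univ,
    add_sub_cancel_right, integral_congr_ae hllr,
    Φ.integral_sum_trajectory P (fun i => measurable_llr _ _) hint n]
  simp_rw [harm]
  rw [ENNReal.ofReal_sum_of_nonneg fun i _ =>
    mul_nonneg (Φ.expectedCount_nonneg P θ i n) ENNReal.toReal_nonneg]
  refine Finset.sum_congr rfl fun i _ => ?_
  rw [ENNReal.ofReal_mul (Φ.expectedCount_nonneg P θ i n), ENNReal.ofReal_toReal (hkl i)]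

lemma Policy.klDiv_trajectoryLaw_update (Φ : Policy G K S) (θ : Fin K → Θ) (j : Fin K) {l : Θ}
    (hkl : kl P (θ j) l ≠ ⊤) (n : ℕ) :
    InformationTheory.klDiv (Φ.trajectoryLaw P θ n)
        (Φ.trajectoryLaw P (Function.update θ j l) n) =
      ENNReal.ofReal (Φ.expectedCount P θ j n) * kl P (θ j) l := by
  have hother : ∀ i, i ≠ j → kl P (θ i) (Function.update θ j l i) = 0 := fun i hi => by
    rw [Function.update_of_ne hi, kl, InformationTheory.klDiv_self]
  have hfin : ∀ i, kl P (θ i) (Function.update θ j l i) ≠ ⊤ := fun i => by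
    rcases eq_or_ne i j with rfl | hi
    · rwa [Function.update_self]
    · simp only [hother i hi, ne_eq, ENNReal.zero_ne_top, not_false_eq_true]
  rw [Φ.klDiv_trajectoryLaw P hfin n, Fintype.sum_eq_single j fun i hi => by
    rw [hother i hi, mul_zero], Function.update_self]

end DivergenceDecomposition

section LowerBound

variable {V Θ S : Type*} {K : ℕ} {G : SimpleGraph V} [Fintype V] [MeasurableSpace S]
  (P : Θ → Measure ℝ) [∀ a, IsProbabilityMeasure (P a)]

lemma Policy.mul_one_sub_le_expectedCount_mul_kl_add_log_two (Φ : Policy G K S) (θ : Fin K → Θ)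
    (j : Fin K) {l : Θ} (hkl : kl P (θ j) l ≠ ⊤) (n : ℕ) {x : ℝ}
    (hx : 1 - Φ.expectedCount P (Function.update θ j l) j n / (Fintype.card (V × Fin n) : ℝ) ≤
      Real.exp (-x)) :
    x * (1 - Φ.expectedCount P θ j n / (Fintype.card (V × Fin n) : ℝ)) ≤
      Φ.expectedCount P θ j n * (kl P (θ j) l).toReal + Real.log 2 := by
  set M : ℝ := (Fintype.card (V × Fin n) : ℝ)
  let u : (V × Fin n → Fin K × ℝ) → ℝ := fun h => 1 - pullCount j h / M
  have hu01 : ∀ h, u h ∈ Set.Icc (0 : ℝ) 1 := fun h =>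
    ⟨sub_nonneg.2 (div_le_one_of_le₀ (Nat.cast_le.2 (pullCount_le_card j h)) (Nat.cast_nonneg _)),
      sub_le_self 1 (by positivity)⟩
  have hu_integral : ∀ η : Fin K → Θ,
      ∫ h, u h ∂Φ.trajectoryLaw P η n = 1 - Φ.expectedCount P η j n / M := fun η => by
    rw [integral_sub (integrable_const 1) ((integrable_pullCount j _).div_const M), integral_div,
      Φ.integral_pullCount P, integral_const, probReal_univ, one_smul]
  have hdiv := Φ.klDiv_trajectoryLaw_update P θ j hkl n
  have hbound := mul_integral_le_toReal_klDiv_add_log_two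
    (((measurable_pullCount j).div_const M).const_sub 1) hu01
    (hdiv ▸ ENNReal.mul_ne_top ENNReal.ofReal_ne_top hkl) ((hu_integral _).trans_le hx)
  rwa [hu_integral, hdiv, ENNReal.toReal_mul,
    ENNReal.toReal_ofReal (Φ.expectedCount_nonneg P θ j n)] at hbound

variable {P}

lemma Policy.Consistent.eventually_one_sub_le_exp [Nonempty V] {Φ : Policy G K S}
    (hΦ : Φ.Consistent P) {θ : Fin K → Θ} {j : Fin K} (hj : ∀ i, i ≠ j → IsSuboptimal P θ i)
    {c : ℝ} (hc : 0 < c) :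
    ∀ᶠ n : ℕ in atTop, 1 - Φ.expectedCount P θ j n / (Fintype.card (V × Fin n) : ℝ) ≤
      Real.exp (-((1 - c) * Real.log n)) := by
  have hsum : (fun n : ℕ => ∑ i ∈ Finset.univ.erase j, Φ.expectedCount P θ i n)
      =o[atTop] fun n : ℕ => (n : ℝ) ^ c :=
    IsLittleO.fun_sum fun i hi => hΦ θ i (hj i (Finset.ne_of_mem_erase hi)) c hc
  filter_upwards [hsum.bound one_pos, eventually_gt_atTop 0] with n hn hn0
  have hn0' : (0 : ℝ) < n := Nat.cast_pos.2 hn0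
  have : Nonempty (Fin n) := ⟨⟨0, hn0⟩⟩
  have hcard : (n : ℝ) ≤ Fintype.card (V × Fin n) := by
    rw [Fintype.card_prod, Fintype.card_fin]
    exact_mod_cast Nat.le_mul_of_pos_left n Fintype.card_pos
  have hothers : Fintype.card (V × Fin n) - Φ.expectedCount P θ j n ≤ (n : ℝ) ^ c := by
    rw [← Φ.sum_expectedCount P θ n, ← Finset.add_sum_erase _ _ (Finset.mem_univ j),
      add_sub_cancel_left]
    rw [one_mul, Real.norm_of_nonneg (Real.rpow_nonneg hn0'.le c)] at hn
    exact (Real.le_norm_self _).trans hn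
  calc 1 - Φ.expectedCount P θ j n / (Fintype.card (V × Fin n) : ℝ)
      = (Fintype.card (V × Fin n) - Φ.expectedCount P θ j n) / Fintype.card (V × Fin n) := by
        rw [sub_div, div_self (hn0'.trans_le hcard).ne']
    _ ≤ (n : ℝ) ^ c / n := by gcongr
    _ = Real.exp (-((1 - c) * Real.log n)) := by
        rw [← Real.rpow_sub_one hn0'.ne', Real.rpow_def_of_pos hn0']
        congr 1
        ring

lemma Policy.Consistent.tendsto_expectedCount_div_card {Φ : Policy G K S}
    (hΦ : Φ.Consistent P) {θ : Fin K → Θ} {j : Fin K} (hj : IsSuboptimal P θ j) :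
    Tendsto (fun n : ℕ => Φ.expectedCount P θ j n / (Fintype.card (V × Fin n) : ℝ)) atTop
      (nhds 0) := by
  have hlim := (hΦ θ j hj 1 one_pos).tendsto_div_nhds_zero.div_const (Fintype.card V : ℝ)
  simp only [Real.rpow_one, zero_div, div_div] at hlim
  simpa only [Fintype.card_prod, Fintype.card_fin, Nat.cast_mul, mul_comm] using hlim

lemma Policy.Consistent.one_sub_div_kl_le_liminf [Nonempty V] {Φ : Policy G K S}
    (hΦ : Φ.Consistent P) {θ : Fin K → Θ} {j : Fin K} (hj : IsSuboptimal P θ j) {l : Θ}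
    (hl : ∀ i, mean P (θ i) < mean P l) (hpos : 0 < kl P (θ j) l) (hfin : kl P (θ j) l < ⊤)
    {c : ℝ} (hc : 0 < c) :
    (((1 - c) / (kl P (θ j) l).toReal : ℝ) : EReal) ≤
      liminf (fun n : ℕ => ((Φ.expectedCount P θ j n / Real.log n : ℝ) : EReal)) atTop := by
  set κ := (kl P (θ j) l).toReal
  have hκ : 0 < κ := ENNReal.toReal_pos hpos.ne' hfin.ne
  have hothers : ∀ i, i ≠ j → IsSuboptimal P (Function.update θ j l) i := fun i hi =>
    ⟨j, by rw [Function.update_self, Function.update_of_ne hi]; exact hl i⟩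
  have hlog : Tendsto (fun n : ℕ => Real.log n) atTop atTop :=
    Real.tendsto_log_atTop.comp tendsto_natCast_atTop_atTop
  have hlim : Tendsto (fun n : ℕ => ((1 - c) *
      (1 - Φ.expectedCount P θ j n / (Fintype.card (V × Fin n) : ℝ)) -
        Real.log 2 / Real.log n) / κ) atTop (nhds ((1 - c) / κ)) := by
    simpa only [sub_zero, mul_one] using
      ((((hΦ.tendsto_expectedCount_div_card hj).const_sub 1).const_mul (1 - c)).sub
        (hlog.const_div_atTop (Real.log 2))).div_const κ
  rw [← ((continuous_coe_real_ereal.tendsto _).comp hlim).liminf_eq]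
  refine liminf_le_liminf ?_
  filter_upwards [hΦ.eventually_one_sub_le_exp hothers hc, hlog.eventually_gt_atTop 0]
    with n hx hlogn
  have hbound := Φ.mul_one_sub_le_expectedCount_mul_kl_add_log_two P θ j hfin.ne n hx
  rw [Function.comp_apply, EReal.coe_le_coe_iff, div_le_div_iff₀ hκ hlogn, sub_mul,
    div_mul_cancel₀ _ hlogn.ne']
  linarith

lemma Policy.Consistent.one_div_kl_le_liminf_of_forall_lt [Nonempty V] {Φ : Policy G K S}
    (hΦ : Φ.Consistent P) {θ : Fin K → Θ} {j : Fin K} (hj : IsSuboptimal P θ j) {l : Θ}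
    (hl : ∀ i, mean P (θ i) < mean P l) (hpos : 0 < kl P (θ j) l) (hfin : kl P (θ j) l < ⊤) :
    ((1 / (kl P (θ j) l).toReal : ℝ) : EReal) ≤
      liminf (fun n : ℕ => ((Φ.expectedCount P θ j n / Real.log n : ℝ) : EReal)) atTop := by
  have hcont : ContinuousAt (fun c : ℝ => (1 - c) / (kl P (θ j) l).toReal) 0 := by fun_prop
  simpa only [sub_zero] using coe_le_of_forall_pos_coe_le hcont fun c hc =>
    hΦ.one_sub_div_kl_le_liminf hj hl hpos hfin hc

end LowerBound

end NetworkBandit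

theorem theorem2_general {V Θ S : Type*} [Fintype V] [Nonempty V] [MeasurableSpace S] {K : ℕ}
    (G : SimpleGraph V) (P : Θ → Measure ℝ) [∀ a, IsProbabilityMeasure (P a)]
    (hP : ∀ a, Integrable (fun x : ℝ => x) (P a))
    (hA1 : NetworkBandit.Regular P)
    (Φ : NetworkBandit.Policy G K S) (hΦ : Φ.Consistent P)
    (θ : Fin K → Θ) (j : Fin K) (hj : NetworkBandit.IsSuboptimal P θ j)
    (i : Fin K) (hi : NetworkBandit.IsOptimal P θ i) :
    ((1 / (NetworkBandit.kl P (θ j) (θ i)).toReal : ℝ) : EReal) ≤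
      liminf (fun n : ℕ => ((Φ.expectedCount P θ j n / Real.log n : ℝ) : EReal)) atTop := by
  have hji : NetworkBandit.mean P (θ j) < NetworkBandit.mean P (θ i) :=
    let ⟨k, hk⟩ := hj
    hk.trans_le (hi k)
  obtain ⟨hpos, hfin⟩ := hA1.pos_finite _ _ hji
  set κ := (NetworkBandit.kl P (θ j) (θ i)).toReal
  have hκ : κ ≠ 0 := (ENNReal.toReal_pos hpos.ne' hfin.ne).ne'
  have hcont : ContinuousAt (fun ε : ℝ => 1 / (κ + ε)) 0 := by
    have : κ + 0 ≠ 0 := by rwa [add_zero]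
    fun_prop (disch := assumption)
  suffices h : ∀ ε, 0 < ε → ((1 / (κ + ε) : ℝ) : EReal) ≤
      liminf (fun n : ℕ => ((Φ.expectedCount P θ j n / Real.log n : ℝ) : EReal)) atTop by
    simpa only [add_zero] using NetworkBandit.coe_le_of_forall_pos_coe_le hcont h
  intro ε hε
  obtain ⟨η, hη, hclose⟩ := hA1.continuous ε hε _ _ hji
  obtain ⟨l, hil, hlη⟩ := hA1.dense (θ i) η hη
  obtain ⟨hlpos, hlfin⟩ := hA1.pos_finite _ _ (hji.trans hil)
  refine le_trans (EReal.coe_le_coe_iff.2 (one_div_le_one_div_of_le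
    (ENNReal.toReal_pos hlpos.ne' hlfin.ne) ?_))
    (hΦ.one_div_kl_le_liminf_of_forall_lt hj (fun k => (hi k).trans_lt hil) hlpos hlfin)
  linarith [(abs_lt.1 (hclose l hil.le hlη.le)).1]

theorem theorem2 {V Θ S : Type*} [Fintype V] [MeasurableSpace S] {K : ℕ}
    (G : SimpleGraph V) (hG : G.Connected)
    (P : Θ → Measure ℝ) [∀ a, IsProbabilityMeasure (P a)]
    (hP : ∀ a, Integrable (fun x : ℝ => x) (P a))
    (hA1 : NetworkBandit.Regular P)
    (Φ : NetworkBandit.Policy G K S) (hΦ : Φ.Consistent P)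
    (θ : Fin K → Θ) (j : Fin K) (hj : NetworkBandit.IsSuboptimal P θ j)
    (i : Fin K) (hi : NetworkBandit.IsOptimal P θ i)
    (δ : ℝ) (hδ : δ ∈ Set.Ioo (0 : ℝ) 1) :
    (((1 - δ) / (1 + δ) * (1 / (NetworkBandit.kl P (θ j) (θ i)).toReal) : ℝ) : EReal) ≤
      liminf (fun n : ℕ => ((Φ.expectedCount P θ j n / Real.log n : ℝ) : EReal)) atTop := by
  have := hG.nonempty
  refine (EReal.coe_le_coe_iff.2 (mul_le_of_le_one_left ?_ ?_)).trans
    (theorem2_general G P hP hA1 Φ hΦ θ j hj i hi)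
  · exact one_div_nonneg.2 ENNReal.toReal_nonneg
  · exact div_le_one_of_le₀ (by linarith [hδ.1]) (by linarith [hδ.1])
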